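/- A bigraph $F=(U_1,U_2,E)$ consists of finite sets $U_1,U_2$ and $E\subseteq U_1\times U_2$. A bigraph property $\mathcal P$ is a class of bigraphs closed under isomorphism (respecting the order of the two classes); it is hereditary if, with every bigraph, it contains all its induced sub-bigraphs (obtained by restricting to $S_1\subseteq U_1$, $S_2\subseteq U_2$). A bigraphon $(J_1,J_2,W)$ consists of probability spaces $(J_1,\pi_1)$, $(J_2,\pi_2)$ and a measurable $W:J_1\times J_2\to[0,1]$. The density of $F$ in it is $$t(F,W)=\int_{J_1^{U_1}}\int_{J_2^{U_2}}\prod_{(i,j)\in E}W(x_i,y_j)\,dy\,dx,$$ and the density $t(F,G)$ of $F$ in a bigraph $G$ with nonempty classes is the density of $F$ in $G$ viewed as a finite bigraphon with uniform measures. The bigraphon is in the closure of $\mathcal P$ if there are $G_1,G_2,\dots\in\mathcal P$ whose numbers of nodes tend to infinity such that $t(F,G_n)\to t(F,W)$ for every bigraph $F$. It is pure if $r_1(x,x')=\|W(x,\cdot)-W(x',\cdot)\|_{L_1(\pi_2)}$ and $r_2(y,y')=\|W(\cdot,y)-W(\cdot,y')\|_{L_1(\pi_1)}$ are defined for all pairs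 of points, $(J_1,r_1)$ and $(J_2,r_2)$ are complete separable metric spaces, and every nonempty open set in $J_1$ and in $J_2$ has positive measure. The packing dimension of a metric space is $\limsup_{\varepsilon\to0}\log N(\varepsilon)/\log(1/\varepsilon)$, where $N(\varepsilon)$ is the maximum number of points mutually at distance at least $\varepsilon$. **Corollary 4.3.** Let $\mathcal P$ be a hereditary bigraph property that does not contain all bigraphs. Then there is a finite number $d$, depending only on $\mathcal P$, such that for every pure bigraphon $(J_1,J_2,W)$ in the closure of $\mathcal P$: $W(x,y)\in\{0,1\}$ for almost all $(x,y)\in J_1\times J_2$; the metric spaces $(J_1,r_1)$ and $(J_2,r_2)$ are compact; and their packing dimensions are at most $d$. -/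

import Mathlib

open MeasureTheory Filter Topology
open scoped ENNReal

/-- A bigraph `(U₁, U₂, E)`: finite sets `U₁` (first class), `U₂` (second class), `E ⊆ U₁ × U₂`. -/
structure Bigraph where
  U₁ : Type
  U₂ : Type
  [fintype₁ : Fintype U₁]
  [fintype₂ : Fintype U₂]
  Adj : U₁ → U₂ → Prop

attribute [instance] Bigraph.fintype₁ Bigraph.fintype₂

namespace Bigraph

/-- Isomorphism of bigraphs (it respects the order of the two classes). -/
def IsIso (F G : Bigraph) : Prop :=
  ∃ (e₁ : F.U₁ ≃ G.U₁) (e₂ : F.U₂ ≃ G.U₂), ∀ i j, F.Adj i j ↔ G.Adj (e₁ i) (e₂ j)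

/-- The sub-bigraph of `G` induced by `S₁ ⊆ U₁` and `S₂ ⊆ U₂`. -/
def induce (G : Bigraph) (S₁ : Finset G.U₁) (S₂ : Finset G.U₂) : Bigraph where
  U₁ := {i // i ∈ S₁}
  U₂ := {j // j ∈ S₂}
  Adj i j := G.Adj i.1 j.1

/-- The density of `F` in the bigraph `G`: the probability that a uniformly random pair of maps
`U₁(F) → U₁(G)`, `U₂(F) → U₂(G)` preserves edges. This is the density of `F` in `G` viewed as a
finite bigraphon with uniform measures. -/
noncomputable def homDensity (F G : Bigraph) : ℝ :=
  (Nat.card {φ : (F.U₁ → G.U₁) × (F.U₂ → G.U₂) //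
      ∀ i j, F.Adj i j → G.Adj (φ.1 i) (φ.2 j)} : ℝ) /
    ((Fintype.card G.U₁ : ℝ) ^ Fintype.card F.U₁ * (Fintype.card G.U₂ : ℝ) ^ Fintype.card F.U₂)

/-- A hereditary bigraph property: a class of bigraphs closed under isomorphism and under taking
induced sub-bigraphs. -/
structure IsHereditary (P : Bigraph → Prop) : Prop where
  iso : ∀ F G : Bigraph, F.IsIso G → P F → P G
  induce : ∀ (G : Bigraph) (S₁ : Finset G.U₁) (S₂ : Finset G.U₂), P G → P (G.induce S₁ S₂)

end Bigraph

/-- `(J₁, J₂, W)` is a bigraphon: `J₁`, `J₂` are probability spaces and `W : J₁ × J₂ → [0, 1]` is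
measurable (with respect to the completed product σ-algebra). -/
structure IsBigraphon {J₁ J₂ : Type*} [MeasurableSpace J₁] [MeasurableSpace J₂]
    (π₁ : Measure J₁) (π₂ : Measure J₂) (W : J₁ → J₂ → ℝ) : Prop where
  prob₁ : IsProbabilityMeasure π₁
  prob₂ : IsProbabilityMeasure π₂
  aemeasurable : AEMeasurable (fun p : J₁ × J₂ => W p.1 p.2) (π₁.prod π₂)
  mem_Icc : ∀ x y, W x y ∈ Set.Icc (0 : ℝ) 1

/-- `(J₁, J₂, W)` is a pure bigraphon. The distances of the two metric spaces are the `L₁`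
distances `r₁`, `r₂` of the rows and of the columns of `W`, which are defined at every pair of
points; both spaces are complete and separable, and every nonempty open set has positive
measure. -/
structure IsPureBigraphon {J₁ J₂ : Type*} [MeasurableSpace J₁] [MeasurableSpace J₂]
    [MetricSpace J₁] [MetricSpace J₂]
    (π₁ : Measure J₁) (π₂ : Measure J₂) (W : J₁ → J₂ → ℝ) : Prop
    extends IsBigraphon π₁ π₂ W where
  aemeasurable_row : ∀ x, AEMeasurable (fun y => W x y) π₂
  aemeasurable_col : ∀ y, AEMeasurable (fun x => W x y) π₁
  dist_eq₁ : ∀ x x' : J₁, dist x x' = ∫ y, |W x y - W x' y| ∂π₂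
  dist_eq₂ : ∀ y y' : J₂, dist y y' = ∫ x, |W x y - W x y'| ∂π₁
  complete₁ : CompleteSpace J₁
  complete₂ : CompleteSpace J₂
  separable₁ : TopologicalSpace.SeparableSpace J₁
  separable₂ : TopologicalSpace.SeparableSpace J₂
  open_pos₁ : π₁.IsOpenPosMeasure
  open_pos₂ : π₂.IsOpenPosMeasure

open Classical in
/-- The density of the bigraph `F` in the bigraphon `(J₁, J₂, W)`, namely
`∫ ∫ ∏_{ij ∈ E(F)} W(x_i, y_j) dy dx`. -/
noncomputable def bigraphonDensity {J₁ J₂ : Type*} [MeasurableSpace J₁] [MeasurableSpace J₂]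
    (F : Bigraph) (π₁ : Measure J₁) (π₂ : Measure J₂) (W : J₁ → J₂ → ℝ) : ℝ :=
  ∫ x : F.U₁ → J₁, (∫ y : F.U₂ → J₂,
    (∏ i, ∏ j, if F.Adj i j then W (x i) (y j) else 1) ∂Measure.pi fun _ => π₂)
    ∂Measure.pi fun _ => π₁

/-- The growing bigraph sequence `G` converges to the bigraphon `(J₁, J₂, W)`: the number of nodes
tends to infinity and the density of every bigraph `F` in `G n` tends to its density in `W`. (The
one-point bigraphs `F` force both classes of `G n` to be nonempty for all large `n`.) -/
structure ConvergesToBigraphon {J₁ J₂ : Type*} [MeasurableSpace J₁] [MeasurableSpace J₂]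
    (G : ℕ → Bigraph) (π₁ : Measure J₁) (π₂ : Measure J₂) (W : J₁ → J₂ → ℝ) : Prop where
  growing : Tendsto (fun n => Fintype.card (G n).U₁ + Fintype.card (G n).U₂) atTop atTop
  tendsto : ∀ F : Bigraph,
    Tendsto (fun n => F.homDensity (G n)) atTop (𝓝 (bigraphonDensity F π₁ π₂ W))

/-- The bigraphon `(J₁, J₂, W)` is in the closure of the bigraph property `P`. -/
def InClosure {J₁ J₂ : Type*} [MeasurableSpace J₁] [MeasurableSpace J₂]
    (P : Bigraph → Prop) (π₁ : Measure J₁) (π₂ : Measure J₂) (W : J₁ → J₂ → ℝ) : Prop :=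
  ∃ G : ℕ → Bigraph, (∀ n, P (G n)) ∧ ConvergesToBigraphon G π₁ π₂ W

/-- `N(ε)`: the maximum number (possibly infinite) of points of `M` mutually at distance at least
`ε`. -/
noncomputable def packingCount (M : Type*) [MetricSpace M] (ε : ℝ) : ℕ∞ :=
  ⨆ (S : Finset M) (_ : ∀ x ∈ S, ∀ y ∈ S, x ≠ y → ε ≤ dist x y), (S.card : ℕ∞)

/-- The (upper) packing dimension `limsup_{ε → 0} log N(ε) / log (1/ε)`. -/
noncomputable def packingDim (M : Type*) [MetricSpace M] : EReal :=
  limsup (fun ε : ℝ => ENNReal.log (packingCount M ε : ℝ≥0∞) / ((Real.log (1 / ε) : ℝ) : EReal))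
    (𝓝[>] 0)

/-!
Every bigraph is an induced sub-bigraph of the membership bigraph between a finite set `V` and its
subsets, so `P` misses such a membership bigraph, and its induced density in `W` vanishes by
inclusion–exclusion. Hence almost every sample of `W` has an entry that is exactly `0` or `1`, and
so has almost every entry. The sets `{y | W x y = 1}` now almost surely shatter no sample of `|V|`
points. For `ε`-separated rows these sets differ pairwise in measure at least `ε`, so a random
sample of `O(log N / ε)` points distinguishes `N` of them, and Sauer–Shelah bounds `N` by a power
of the sample size. Thus `N(ε)` is polynomial in `1 / ε`, with an exponent depending only on `V`.
-/

namespace Bigraph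

/-- `F` is isomorphic to an induced sub-bigraph of `G`. -/
def IsInducedIn (F G : Bigraph) : Prop :=
  ∃ (f : F.U₁ ↪ G.U₁) (g : F.U₂ ↪ G.U₂), ∀ i j, F.Adj i j ↔ G.Adj (f i) (g j)

/-- No two nodes in the same class have the same neighbours. For such bigraphs every map that
preserves both adjacency and non-adjacency is an embedding. -/
structure IsTwinFree (F : Bigraph) : Prop where
  left : ∀ i i', (∀ j, F.Adj i j ↔ F.Adj i' j) → i = i'
  right : ∀ j j', (∀ i, F.Adj i j ↔ F.Adj i j') → j = j'

/-- The bigraph with its two classes exchanged. -/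
def flip (F : Bigraph) : Bigraph where
  U₁ := F.U₂
  U₂ := F.U₁
  Adj j i := F.Adj i j

/-- The membership bigraph between the subsets of `V` and the elements of `V`; its occurrences are
the shattered sets of Vapnik–Chervonenkis theory. -/
def ofSubsets (V : Type) [Fintype V] : Bigraph where
  U₁ := Finset V
  U₂ := V
  Adj s v := v ∈ s

lemma IsInducedIn.flip {F G : Bigraph} : F.IsInducedIn G → F.flip.IsInducedIn G.flip :=
  fun ⟨f, g, h⟩ => ⟨g, f, fun j i => h i j⟩

lemma IsTwinFree.flip {F : Bigraph} (hF : F.IsTwinFree) : F.flip.IsTwinFree :=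
  ⟨hF.right, hF.left⟩

lemma isTwinFree_ofSubsets (V : Type) [Fintype V] : (ofSubsets V).IsTwinFree where
  left _ _ h := Finset.ext h
  right v _ h :=
    (Finset.mem_singleton.1 ((h ({v} : Finset V)).1 (Finset.mem_singleton_self v))).symm

lemma IsTwinFree.isInducedIn {F G : Bigraph} (hF : F.IsTwinFree) {f : F.U₁ → G.U₁}
    {g : F.U₂ → G.U₂} (h : ∀ i j, F.Adj i j ↔ G.Adj (f i) (g j)) : F.IsInducedIn G :=
  ⟨⟨f, fun i i' hi => hF.left i i' fun j => by rw [h, h, hi]⟩,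
    ⟨g, fun j j' hj => hF.right j j' fun i => by rw [h, h, hj]⟩, h⟩

lemma IsIso.symm {F G : Bigraph} : F.IsIso G → G.IsIso F :=
  fun ⟨e₁, e₂, h⟩ => ⟨e₁.symm, e₂.symm, fun a b => by simp [h]⟩

lemma IsHereditary.of_isInducedIn {P : Bigraph → Prop} (hP : IsHereditary P) {F G : Bigraph}
    (hFG : F.IsInducedIn G) (hG : P G) : P F := by
  obtain ⟨f, g, h⟩ := hFG
  let e₁ : F.U₁ ≃ {a // a ∈ Finset.univ.map f} :=
    (Equiv.ofInjective f f.injective).trans (Equiv.subtypeEquivRight fun a => by simp)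
  let e₂ : F.U₂ ≃ {b // b ∈ Finset.univ.map g} :=
    (Equiv.ofInjective g g.injective).trans (Equiv.subtypeEquivRight fun b => by simp)
  have hiso : F.IsIso (G.induce (Finset.univ.map f) (Finset.univ.map g)) := ⟨e₁, e₂, h⟩
  exact hP.iso _ F hiso.symm (hP.induce G _ _ hG)

lemma isInducedIn_ofSubsets (F : Bigraph) {V : Type} [Fintype V] (a : F.U₁ ↪ V) (b : F.U₂ ↪ V)
    (hab : ∀ i j, a i ≠ b j) : F.IsInducedIn (ofSubsets V) := by
  classical
  -- The extra element `a i` separates nodes with the same neighbours.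
  let nbhd (i : F.U₁) : Finset V := {v | v = a i ∨ ∃ j, v = b j ∧ F.Adj i j}
  have hnbhd : nbhd.Injective := fun i i' hi => by
    have : a i ∈ nbhd i' := hi ▸ by simp [nbhd]
    simpa [nbhd, hab] using this
  refine ⟨⟨nbhd, hnbhd⟩, b, fun i j => ?_⟩
  change F.Adj i j ↔ b j ∈ nbhd i
  simp [nbhd, (hab _ _).symm]

lemma IsHereditary.exists_not_ofSubsets {P : Bigraph → Prop} (hP : IsHereditary P)
    (hne : ∃ F, ¬ P F) :
    ∃ (V : Type) (_ : Fintype V), ¬ P (ofSubsets V) ∧ ¬ P (ofSubsets V).flip := by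
  obtain ⟨F, hF⟩ := hne
  have h₁ : F.IsInducedIn (ofSubsets (F.U₁ ⊕ F.U₂)) :=
    F.isInducedIn_ofSubsets .inl .inr fun _ _ => Sum.inl_ne_inr
  have h₂ : F.flip.IsInducedIn (ofSubsets (F.U₁ ⊕ F.U₂)) :=
    F.flip.isInducedIn_ofSubsets .inr .inl fun _ _ => Sum.inr_ne_inl
  exact ⟨F.U₁ ⊕ F.U₂, inferInstance, fun h => hF (hP.of_isInducedIn h₁ h),
    fun h => hF (hP.of_isInducedIn h₂.flip h)⟩

section Weights

variable {α β : Type*}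

open Classical in
/-- The integrand `∏_{ij ∈ E(F)} W(x_i, y_j)` of the density of `F`. -/
noncomputable def homWeight (F : Bigraph) (W : α → β → ℝ) (x : F.U₁ → α) (y : F.U₂ → β) : ℝ :=
  ∏ i, ∏ j, if F.Adj i j then W (x i) (y j) else 1

open Classical in
/-- The integrand `∏_{ij ∈ E(F)} W(x_i, y_j) ∏_{ij ∉ E(F)} (1 - W(x_i, y_j))` of the induced
density of `F`. -/
noncomputable def indWeight (F : Bigraph) (W : α → β → ℝ) (x : F.U₁ → α) (y : F.U₂ → β) : ℝ :=
  ∏ i, ∏ j, if F.Adj i j then W (x i) (y j) else 1 - W (x i) (y j)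

open Classical in
/-- The pairs of nodes in different classes that are not edges. -/
noncomputable def nonEdges (F : Bigraph) : Finset (F.U₁ × F.U₂) := {p | ¬ F.Adj p.1 p.2}

/-- The bigraph `F` with the pairs in `t` added to its edges. -/
def addEdges (F : Bigraph) (t : Finset (F.U₁ × F.U₂)) : Bigraph where
  U₁ := F.U₁
  U₂ := F.U₂
  Adj i j := F.Adj i j ∨ (i, j) ∈ t

open Classical in
/-- The `0`-`1` matrix of adjacencies, through which a bigraph is a finite bigraphon. -/
noncomputable def adjMatrix (G : Bigraph) : G.U₁ → G.U₂ → ℝ :=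
  fun a b => if G.Adj a b then 1 else 0

lemma homWeight_mem_Icc (F : Bigraph) {W : α → β → ℝ} (hW : ∀ a b, W a b ∈ Set.Icc (0 : ℝ) 1)
    (x : F.U₁ → α) (y : F.U₂ → β) : F.homWeight W x y ∈ Set.Icc (0 : ℝ) 1 := by
  classical
  have h (i j) : (if F.Adj i j then W (x i) (y j) else 1) ∈ Set.Icc (0 : ℝ) 1 := by
    split_ifs
    exacts [hW _ _, ⟨zero_le_one, le_rfl⟩]
  exact ⟨Finset.prod_nonneg fun i _ => Finset.prod_nonneg fun j _ => (h i j).1,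
    Finset.prod_le_one (fun i _ => Finset.prod_nonneg fun j _ => (h i j).1)
      fun i _ => Finset.prod_le_one (fun j _ => (h i j).1) fun j _ => (h i j).2⟩

lemma indWeight_nonneg (F : Bigraph) {W : α → β → ℝ} (hW : ∀ a b, W a b ∈ Set.Icc (0 : ℝ) 1)
    (x : F.U₁ → α) (y : F.U₂ → β) : 0 ≤ F.indWeight W x y := by
  refine Finset.prod_nonneg fun i _ => Finset.prod_nonneg fun j _ => ?_
  split_ifs
  exacts [(hW _ _).1, sub_nonneg.2 (hW _ _).2]

lemma indWeight_eq_zero_iff {F : Bigraph} {W : α → β → ℝ} {x : F.U₁ → α} {y : F.U₂ → β} :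
    F.indWeight W x y = 0 ↔
      ∃ i j, F.Adj i j ∧ W (x i) (y j) = 0 ∨ ¬ F.Adj i j ∧ W (x i) (y j) = 1 := by
  simp only [indWeight, Finset.prod_eq_zero_iff, Finset.mem_univ, true_and, ite_eq_iff, sub_eq_zero,
    eq_comm (a := (1 : ℝ))]

lemma indWeight_flip (F : Bigraph) (W : α → β → ℝ) (x : F.U₁ → α) (y : F.U₂ → β) :
    F.flip.indWeight (fun b a => W a b) y x = F.indWeight W x y :=
  Finset.prod_comm

lemma homWeight_addEdges {F : Bigraph} {t : Finset (F.U₁ × F.U₂)} (ht : t ⊆ F.nonEdges)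
    (W : α → β → ℝ) (x : F.U₁ → α) (y : F.U₂ → β) :
    (F.addEdges t).homWeight W x y = F.homWeight W x y * ∏ p ∈ t, W (x p.1) (y p.2) := by
  classical
  have ht' (i j) (hij : (i, j) ∈ t) : ¬ F.Adj i j := by simpa [nonEdges] using ht hij
  have hprod : ∏ p ∈ t, W (x p.1) (y p.2) =
      ∏ i, ∏ j, if (i, j) ∈ t then W (x i) (y j) else 1 := by
    rw [← Fintype.prod_prod_type', Finset.prod_ite_mem, Finset.univ_inter]
  simp only [homWeight, hprod, ← Finset.prod_mul_distrib]
  refine Finset.prod_congr rfl fun i _ => Finset.prod_congr rfl fun j _ => ?_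
  have := ht' i j
  by_cases h : F.Adj i j <;> simp_all [addEdges]

lemma indWeight_eq_sum (F : Bigraph) (W : α → β → ℝ) (x : F.U₁ → α) (y : F.U₂ → β) :
    F.indWeight W x y =
      ∑ t ∈ F.nonEdges.powerset, (-1) ^ t.card * (F.addEdges t).homWeight W x y := by
  classical
  have hsplit : F.indWeight W x y =
      F.homWeight W x y * ∏ p ∈ F.nonEdges, (1 - W (x p.1) (y p.2)) := by
    simp only [indWeight, homWeight, nonEdges, Finset.prod_filter, Fintype.prod_prod_type,
      ← Finset.prod_mul_distrib]
    refine Finset.prod_congr rfl fun i _ => Finset.prod_congr rfl fun j _ => ?_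
    split_ifs <;> simp
  rw [hsplit, Finset.prod_sub, Finset.mul_sum]
  refine Finset.sum_congr rfl fun t ht => ?_
  rw [homWeight_addEdges (Finset.mem_powerset.1 ht), Finset.prod_const_one]
  ring

lemma indWeight_adjMatrix_eq_zero {F G : Bigraph} (hF : F.IsTwinFree) (hFG : ¬ F.IsInducedIn G)
    (x : F.U₁ → G.U₁) (y : F.U₂ → G.U₂) : F.indWeight G.adjMatrix x y = 0 := by
  rw [indWeight_eq_zero_iff]
  have h : ¬ ∀ i j, F.Adj i j ↔ G.Adj (x i) (y j) := fun h => hFG (hF.isInducedIn h)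
  push Not at h
  simpa [adjMatrix] using h

open Classical in
open scoped BigOperators in
lemma homDensity_eq_expect (F G : Bigraph) :
    F.homDensity G =
      𝔼 p : (F.U₁ → G.U₁) × (F.U₂ → G.U₂), F.homWeight G.adjMatrix p.1 p.2 := by
  have hweight (p : (F.U₁ → G.U₁) × (F.U₂ → G.U₂)) : F.homWeight G.adjMatrix p.1 p.2 =
      if ∀ i j, F.Adj i j → G.Adj (p.1 i) (p.2 j) then 1 else 0 := by
    split_ifs with h
    · exact Finset.prod_eq_one fun i _ => Finset.prod_eq_one fun j _ => by simp_all [adjMatrix]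
    · push Not at h
      obtain ⟨i, j, hF, hG⟩ := h
      exact Finset.prod_eq_zero (Finset.mem_univ i) <| Finset.prod_eq_zero (Finset.mem_univ j) <| by
        simp [adjMatrix, hF, hG]
  simp only [hweight, Fintype.expect_eq_sum_div_card, Finset.sum_boole, homDensity,
    Nat.card_eq_fintype_card, Fintype.card_subtype, Fintype.card_prod, Fintype.card_fun,
    Nat.cast_mul, Nat.cast_pow]

open scoped BigOperators in
lemma sum_homDensity_addEdges_eq_zero {F G : Bigraph} (hF : F.IsTwinFree)
    (hFG : ¬ F.IsInducedIn G) :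
    ∑ t ∈ F.nonEdges.powerset, (-1) ^ t.card * (F.addEdges t).homDensity G = 0 := by
  classical
  calc ∑ t ∈ F.nonEdges.powerset, (-1) ^ t.card * (F.addEdges t).homDensity G
      = 𝔼 p : (F.U₁ → G.U₁) × (F.U₂ → G.U₂), F.indWeight G.adjMatrix p.1 p.2 := by
        simp only [indWeight_eq_sum, Finset.expect_sum_comm, ← Finset.mul_expect,
          homDensity_eq_expect]
        rfl
    _ = 0 := Finset.expect_eq_zero fun p _ => indWeight_adjMatrix_eq_zero hF hFG p.1 p.2

end Weights

end Bigraph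

section Sampling

variable {J₁ J₂ : Type*} [MeasurableSpace J₁] [MeasurableSpace J₂]
  {π₁ : Measure J₁} {π₂ : Measure J₂} {W : J₁ → J₂ → ℝ}

/-- The law of independent random points of `J₁` and `J₂`, one for each node of `F`. -/
noncomputable abbrev Bigraph.sampleMeasure (F : Bigraph) (π₁ : Measure J₁) (π₂ : Measure J₂) :
    Measure ((F.U₁ → J₁) × (F.U₂ → J₂)) :=
  (Measure.pi fun _ => π₁).prod (Measure.pi fun _ => π₂)

/-- The induced density of `F` in the bigraphon `(J₁, J₂, W)` vanishes. -/
def Bigraph.IsAvoidedBy (F : Bigraph) (π₁ : Measure J₁) (π₂ : Measure J₂) (W : J₁ → J₂ → ℝ) :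
    Prop :=
  ∀ᵐ p ∂F.sampleMeasure π₁ π₂, F.indWeight W p.1 p.2 = 0

lemma Bigraph.IsAvoidedBy.of_flip {F : Bigraph} [SigmaFinite π₁] [SigmaFinite π₂]
    (hF : F.flip.IsAvoidedBy π₁ π₂ W) : F.IsAvoidedBy π₂ π₁ fun b a => W a b := by
  have h := (Measure.measurePreserving_swap (μ := Measure.pi fun _ : F.U₁ => π₂)
    (ν := Measure.pi fun _ : F.U₂ => π₁)).quasiMeasurePreserving.ae hF
  filter_upwards [h] with p hp
  rwa [← F.indWeight_flip]

namespace IsBigraphon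

lemma aemeasurable_eval (hW : IsBigraphon π₁ π₂ W) {ι κ : Type*} [Fintype ι] [Fintype κ]
    (i : ι) (j : κ) :
    AEMeasurable (fun p : (ι → J₁) × (κ → J₂) => W (p.1 i) (p.2 j))
      ((Measure.pi fun _ => π₁).prod (Measure.pi fun _ => π₂)) := by
  have := hW.prob₁
  have := hW.prob₂
  exact hW.aemeasurable.comp_quasiMeasurePreserving
    ((measurePreserving_eval (fun _ : ι => π₁) i).prod
      (measurePreserving_eval (fun _ : κ => π₂) j)).quasiMeasurePreserving

lemma integrable_homWeight (hW : IsBigraphon π₁ π₂ W) (F : Bigraph) :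
    Integrable (fun p => F.homWeight W p.1 p.2) (F.sampleMeasure π₁ π₂) := by
  classical
  have := hW.prob₁
  have := hW.prob₂
  have hmeas : AEMeasurable (fun p => F.homWeight W p.1 p.2) (F.sampleMeasure π₁ π₂) := by
    refine Finset.aemeasurable_fun_prod _ fun i _ => Finset.aemeasurable_fun_prod _ fun j _ => ?_
    split_ifs
    exacts [hW.aemeasurable_eval i j, aemeasurable_const]
  refine .of_bound hmeas.aestronglyMeasurable 1 (.of_forall fun p => ?_)
  obtain ⟨h₀, h₁⟩ := F.homWeight_mem_Icc hW.mem_Icc p.1 p.2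
  rwa [Real.norm_of_nonneg h₀]

lemma bigraphonDensity_eq (hW : IsBigraphon π₁ π₂ W) (F : Bigraph) :
    bigraphonDensity F π₁ π₂ W = ∫ p, F.homWeight W p.1 p.2 ∂F.sampleMeasure π₁ π₂ := by
  have := hW.prob₁
  have := hW.prob₂
  rw [integral_prod _ (hW.integrable_homWeight F)]
  rfl

lemma integrable_indWeight (hW : IsBigraphon π₁ π₂ W) (F : Bigraph) :
    Integrable (fun p => F.indWeight W p.1 p.2) (F.sampleMeasure π₁ π₂) := by
  simp only [F.indWeight_eq_sum]
  exact integrable_finsetSum _ fun t _ => (hW.integrable_homWeight (F.addEdges t)).const_mul _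

lemma integral_indWeight (hW : IsBigraphon π₁ π₂ W) (F : Bigraph) :
    ∫ p, F.indWeight W p.1 p.2 ∂F.sampleMeasure π₁ π₂ =
      ∑ t ∈ F.nonEdges.powerset, (-1) ^ t.card * bigraphonDensity (F.addEdges t) π₁ π₂ W := by
  simp only [F.indWeight_eq_sum, hW.bigraphonDensity_eq, ← integral_const_mul]
  exact integral_finsetSum _ fun t _ => (hW.integrable_homWeight (F.addEdges t)).const_mul _

lemma isAvoidedBy_of_inClosure (hW : IsBigraphon π₁ π₂ W) {P : Bigraph → Prop}
    (hP : Bigraph.IsHereditary P) (hcl : InClosure P π₁ π₂ W) {F : Bigraph} (hF : F.IsTwinFree)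
    (hPF : ¬ P F) : F.IsAvoidedBy π₁ π₂ W := by
  obtain ⟨G, hG, hlim⟩ := hcl
  have hzero (n : ℕ) :
      ∑ t ∈ F.nonEdges.powerset, (-1) ^ t.card * (F.addEdges t).homDensity (G n) = 0 :=
    Bigraph.sum_homDensity_addEdges_eq_zero hF fun h => hPF (hP.of_isInducedIn h (hG n))
  have hint : ∫ p, F.indWeight W p.1 p.2 ∂F.sampleMeasure π₁ π₂ = 0 := by
    have hsum := tendsto_finsetSum F.nonEdges.powerset fun t _ =>
      (hlim.tendsto (F.addEdges t)).const_mul ((-1) ^ t.card)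
    simp only [hzero] at hsum
    rw [hW.integral_indWeight, tendsto_nhds_unique hsum tendsto_const_nhds]
  have hnonneg : 0 ≤ fun p : (F.U₁ → J₁) × (F.U₂ → J₂) => F.indWeight W p.1 p.2 :=
    fun p => F.indWeight_nonneg hW.mem_Icc p.1 p.2
  filter_upwards [(integral_eq_zero_iff_of_nonneg hnonneg (hW.integrable_indWeight F)).1 hint]
    with p hp using hp

end IsBigraphon

lemma ae_of_ae_pi_exists {Ω ι : Type*} [MeasurableSpace Ω] {μ : Measure Ω} [SigmaFinite μ]
    [Fintype ι] {p : Ω → Prop} (h : ∀ᵐ x : ι → Ω ∂Measure.pi fun _ => μ, ∃ i, p (x i)) :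
    ∀ᵐ a ∂μ, p a := by
  have hnull : (Measure.pi fun _ : ι => μ) (Set.univ.pi fun _ => {a | ¬ p a}) = 0 := by
    rw [← ae_iff.1 h]
    congr 1
    ext x
    simp
  rw [Measure.pi_pi, Finset.prod_eq_zero_iff] at hnull
  obtain ⟨i, -, hi⟩ := hnull
  exact ae_iff.2 hi

lemma ae_prod_of_ae_pi_exists {ι κ : Type*} [Fintype ι] [Fintype κ] [SigmaFinite π₁]
    [SigmaFinite π₂] {p : J₁ × J₂ → Prop} (hp : MeasurableSet {z | p z})
    (h : ∀ᵐ z : (ι → J₁) × (κ → J₂) ∂(Measure.pi fun _ => π₁).prod (Measure.pi fun _ => π₂),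
      ∃ i j, p (z.1 i, z.2 j)) : ∀ᵐ z ∂π₁.prod π₂, p z := by
  have hrow : ∀ᵐ x : ι → J₁ ∂Measure.pi fun _ => π₁, ∀ᵐ b ∂π₂, ∃ i, p (x i, b) := by
    filter_upwards [Measure.ae_ae_of_ae_prod h] with x hx
    exact ae_of_ae_pi_exists (ι := κ) (hx.mono fun y ⟨i, j, hij⟩ => ⟨j, i, hij⟩)
  have hmeas : MeasurableSet {z : (ι → J₁) × J₂ | ∃ i, p (z.1 i, z.2)} := by
    simp only [Set.ofPred_exists]
    exact .iUnion fun i => hp.preimage (by fun_prop)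
  rw [Measure.ae_prod_iff_ae_ae hp, Measure.ae_ae_comm (p := fun a b => p (a, b)) hp]
  filter_upwards [(Measure.ae_ae_comm hmeas).1 hrow] with b hb
  exact ae_of_ae_pi_exists hb

lemma IsBigraphon.ae_zero_or_one (hW : IsBigraphon π₁ π₂ W) {F : Bigraph}
    (hF : F.IsAvoidedBy π₁ π₂ W) : ∀ᵐ z ∂π₁.prod π₂, W z.1 z.2 = 0 ∨ W z.1 z.2 = 1 := by
  have := hW.prob₁
  have := hW.prob₂
  obtain ⟨f, hf, hWf⟩ := hW.aemeasurable
  have heval (i : F.U₁) (j : F.U₂) :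
      ∀ᵐ p ∂F.sampleMeasure π₁ π₂, W (p.1 i) (p.2 j) = f (p.1 i, p.2 j) :=
    ((measurePreserving_eval (fun _ => π₁) i).prod
      (measurePreserving_eval (fun _ => π₂) j)).quasiMeasurePreserving.ae hWf
  have hmeas : MeasurableSet {z | f z = 0 ∨ f z = 1} :=
    (hf (measurableSet_singleton 0)).union (hf (measurableSet_singleton 1))
  have hf01 : ∀ᵐ z ∂π₁.prod π₂, f z = 0 ∨ f z = 1 := by
    refine ae_prod_of_ae_pi_exists (ι := F.U₁) (κ := F.U₂) hmeas ?_
    filter_upwards [hF, eventually_all.2 fun i => eventually_all.2 (heval i)] with p hp hpf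
    obtain ⟨i, j, hij⟩ := Bigraph.indWeight_eq_zero_iff.1 hp
    exact ⟨i, j, hpf i j ▸ hij.imp And.right And.right⟩
  filter_upwards [hf01, hWf] with z hz hzf
  rwa [hzf]

end Sampling

section Packing

/-- The family of sets `A` shatters the points `y v`: its members cut out every subset of them. -/
def FamilyShatters {ι V Ω : Type*} (A : ι → Set Ω) (y : V → Ω) : Prop :=
  ∀ s : Finset V, ∃ i, ∀ v, y v ∈ A i ↔ v ∈ s

lemma FamilyShatters.exists_embedding {ι V Ω : Type*} {A : ι → Set Ω} {y : V → Ω}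
    (h : FamilyShatters A y) : ∃ g : Finset V ↪ ι, ∀ s v, y v ∈ A (g s) ↔ v ∈ s := by
  choose g hg using h
  exact ⟨⟨g, fun s s' hs => Finset.ext fun v => by rw [← hg, ← hg, hs]⟩, hg⟩

lemma sum_choose_le_pow (m k : ℕ) : ∑ i ∈ Finset.Iic k, m.choose i ≤ (m + 1) ^ k := by
  rw [add_pow, Nat.range_succ_eq_Iic]
  refine Finset.sum_le_sum fun i hi => ?_
  rw [one_pow, mul_one]
  exact (Nat.choose_le_pow m i).trans
    (Nat.le_mul_of_pos_right _ (Nat.choose_pos (Finset.mem_Iic.1 hi)))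

section SauerShelah

variable {ι α V : Type*} [Fintype V]

lemma exists_familyShatters_of_shatters [DecidableEq α] {𝒜 : Finset (Finset α)} {A : ι → Set α}
    (h𝒜 : ∀ u ∈ 𝒜, ∃ i, A i = u) {T : Finset α} (hT : 𝒜.Shatters T)
    (hVT : Fintype.card V ≤ T.card) :
    ∃ h : V ↪ α, FamilyShatters A h := by
  obtain ⟨e⟩ : Nonempty (V ↪ T) := by
    rwa [Function.Embedding.nonempty_iff_card_le, Fintype.card_coe]
  let h : V ↪ α := e.trans (.subtype _)
  refine ⟨h, fun s => ?_⟩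
  have hs : s.map h ⊆ T := by
    intro a ha
    obtain ⟨v, -, rfl⟩ := Finset.mem_map.1 ha
    exact (e v).2
  obtain ⟨u, hu, hTu⟩ := hT hs
  obtain ⟨i, hi⟩ := h𝒜 u hu
  have hmem (v : V) : h v ∈ T ∩ u ↔ v ∈ s := by rw [hTu, Finset.mem_map']
  exact ⟨i, fun v => by simpa [hi, h] using hmem v⟩

lemma card_le_pow_of_not_familyShatters [Fintype ι] [Fintype α] {A : ι → Set α}
    (hinj : A.Injective) (hA : ∀ h : V ↪ α, ¬ FamilyShatters A h) :
    Fintype.card ι ≤ (Fintype.card α + 1) ^ Fintype.card V := by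
  classical
  let 𝒜 : Finset (Finset α) := Finset.univ.image fun i => (A i).toFinset
  have h𝒜 (u) (hu : u ∈ 𝒜) : ∃ i, A i = u := by
    obtain ⟨i, -, rfl⟩ := Finset.mem_image.1 hu
    exact ⟨i, by simp⟩
  have hdim : 𝒜.vcDim ≤ Fintype.card V := Finset.sup_le fun T hT => by
    by_contra! hlt
    obtain ⟨h, hh⟩ := exists_familyShatters_of_shatters h𝒜 (Finset.mem_shatterer.1 hT) hlt.le
    exact hA h hh
  have hcard : 𝒜.card = Fintype.card ι :=
    Finset.card_image_of_injective _ fun i i' h => hinj (Set.toFinset_inj.1 h)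
  calc Fintype.card ι ≤ 𝒜.shatterer.card := hcard ▸ Finset.card_le_card_shatterer 𝒜
    _ ≤ ∑ k ∈ Finset.Iic 𝒜.vcDim, (Fintype.card α).choose k := Finset.card_shatterer_le_sum_vcDim
    _ ≤ (Fintype.card α + 1) ^ 𝒜.vcDim := sum_choose_le_pow _ _
    _ ≤ (Fintype.card α + 1) ^ Fintype.card V := by gcongr; omega

end SauerShelah

section RandomSample

variable {Ω : Type*} [MeasurableSpace Ω] {μ : Measure Ω} [IsProbabilityMeasure μ]

lemma measurePreserving_pi_comp {ι κ : Type*} [Fintype ι] [Fintype κ] (g : κ ↪ ι) :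
    MeasurePreserving (fun (x : ι → Ω) k => x (g k)) (Measure.pi fun _ => μ)
      (Measure.pi fun _ => μ) := by
  have heval (i : ι) : (Measure.pi fun _ => μ).map (fun x : ι → Ω => x i) = μ :=
    (measurePreserving_eval (fun _ => μ) i).map_eq
  have hindep : ProbabilityTheory.iIndepFun (fun (i : ι) (x : ι → Ω) => x i)
      (Measure.pi fun _ => μ) :=
    ProbabilityTheory.iIndepFun_pi (X := fun _ => id) fun _ => aemeasurable_id
  refine ⟨by fun_prop, ?_⟩
  rw [(hindep.precomp g.injective).map_fun_eq_pi_map fun k => (measurable_pi_apply _).aemeasurable]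
  simp only [heval]

lemma ae_pi_forall_comp {ι κ : Type*} [Fintype ι] [Fintype κ] {p : (κ → Ω) → Prop}
    (h : ∀ᵐ y ∂Measure.pi fun _ : κ => μ, p y) :
    ∀ᵐ x ∂Measure.pi fun _ : ι => μ, ∀ g : κ ↪ ι, p fun k => x (g k) :=
  eventually_all.2 fun g => (measurePreserving_pi_comp g).quasiMeasurePreserving.ae h

lemma measureReal_pi_forall_notMem_le {B : Set Ω} (hB : NullMeasurableSet B μ) {ε : ℝ}
    (hε : ε ≤ μ.real B) (m : ℕ) :
    (Measure.pi fun _ : Fin m => μ).real {y | ∀ j, y j ∉ B} ≤ (1 - ε) ^ m := by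
  have hpi : {y : Fin m → Ω | ∀ j, y j ∉ B} = Set.univ.pi fun _ => Bᶜ := by ext; simp
  calc (Measure.pi fun _ : Fin m => μ).real {y | ∀ j, y j ∉ B}
      = μ.real Bᶜ ^ m := by simp [measureReal_def, hpi, Measure.pi_pi]
    _ ≤ (1 - ε) ^ m := by
        gcongr
        rw [probReal_compl_eq_one_sub₀ hB]
        linarith

lemma exists_sample_hitting {κ : Type*} {T : Finset κ} {B : κ → Set Ω}
    (hB : ∀ k, NullMeasurableSet (B k) μ) {ε : ℝ} (hε : ∀ k ∈ T, ε ≤ μ.real (B k)) {m : ℕ}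
    (hm : T.card * (1 - ε) ^ m < 1) {p : (Fin m → Ω) → Prop}
    (hp : ∀ᵐ y ∂Measure.pi fun _ => μ, p y) : ∃ y, p y ∧ ∀ k ∈ T, ∃ j, y j ∈ B k := by
  by_contra! hcon
  have hcover : (⋃ k ∈ T, {y | ∀ j, y j ∉ B k}) =ᵐ[Measure.pi fun _ : Fin m => μ] Set.univ :=
    eventuallyEq_univ.2 <| by
      filter_upwards [hp] with y hy
      simpa using hcon y hy
  refine hm.not_ge ?_
  calc 1 = (Measure.pi fun _ : Fin m => μ).real (⋃ k ∈ T, {y | ∀ j, y j ∉ B k}) := by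
        rw [measureReal_congr hcover, probReal_univ]
    _ ≤ ∑ k ∈ T, (Measure.pi fun _ : Fin m => μ).real {y | ∀ j, y j ∉ B k} :=
        measureReal_biUnion_finset_le _ _
    _ ≤ ∑ _k ∈ T, (1 - ε) ^ m :=
        Finset.sum_le_sum fun k hk => measureReal_pi_forall_notMem_le (hB k) (hε k hk) m
    _ = T.card * (1 - ε) ^ m := by rw [Finset.sum_const, nsmul_eq_mul]

end RandomSample

lemma sq_mul_one_sub_pow_lt_one {d m : ℕ} (hd : d ≠ 0) {s ε : ℝ} (hs : 0 ≤ s) (hε : ε ≤ 1)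
    (hm : 4 * d * s ≤ ε * m) : (s ^ (2 * d)) ^ 2 * (1 - ε) ^ m < 1 := by
  have hpow : (1 - ε) ^ m ≤ Real.exp (-s) ^ (4 * d) := calc
    (1 - ε) ^ m ≤ Real.exp (-ε) ^ m :=
        pow_le_pow_left₀ (sub_nonneg.2 hε) (Real.one_sub_le_exp_neg ε) m
    _ ≤ Real.exp (-s) ^ (4 * d) := by
        rw [← Real.exp_nat_mul, ← Real.exp_nat_mul, Real.exp_le_exp]
        push_cast
        linarith
  have hlt : s * Real.exp (-s) < 1 := by
    rw [Real.exp_neg, ← div_eq_mul_inv, div_lt_one (Real.exp_pos s)]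
    linarith [Real.add_one_le_exp s]
  calc (s ^ (2 * d)) ^ 2 * (1 - ε) ^ m
      ≤ (s ^ (2 * d)) ^ 2 * Real.exp (-s) ^ (4 * d) := by gcongr
    _ = (s * Real.exp (-s)) ^ (4 * d) := by ring
    _ < 1 := pow_lt_one₀ (by positivity) hlt (by omega)

lemma le_pow_of_forall_sample_le {N d : ℕ} {ε : ℝ} (hε₀ : 0 < ε) (hε₁ : ε ≤ 1)
    (h : ∀ m : ℕ, (N : ℝ) ^ 2 * (1 - ε) ^ m < 1 → N ≤ (m + 1) ^ d) :
    (N : ℝ) ≤ ((4 * d + 2) / ε) ^ (2 * d) := by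
  rcases Nat.eq_zero_or_pos N with rfl | hN
  · rw [Nat.cast_zero]
    positivity
  rcases eq_or_ne d 0 with rfl | hd
  · have hlim := (tendsto_pow_atTop_nhds_zero_of_lt_one (sub_nonneg.2 hε₁)
      (sub_lt_self 1 hε₀)).const_mul ((N : ℝ) ^ 2)
    obtain ⟨m, hm⟩ := (hlim.eventually_lt_const (by simp : (N : ℝ) ^ 2 * 0 < 1)).exists
    simpa using h m hm
  -- The sample size `m ≈ 4 d s / ε` turns `N ≤ (m + 1) ^ d` into `s ^ (2 * d) ≤ O(s / ε) ^ d`.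
  set s : ℝ := (N : ℝ) ^ (((2 * d : ℕ) : ℝ)⁻¹)
  have hs : 1 ≤ s := Real.one_le_rpow (by exact_mod_cast hN) (by positivity)
  have hsN : s ^ (2 * d) = N := Real.rpow_inv_natCast_pow N.cast_nonneg (by omega)
  set m : ℕ := ⌈4 * d * s / ε⌉₊
  have hm : 4 * d * s ≤ ε * m := (div_le_iff₀' hε₀).1 (Nat.le_ceil _)
  have hNm : (N : ℝ) ≤ (m + 1) ^ d := by
    exact_mod_cast h m (hsN ▸ sq_mul_one_sub_pow_lt_one hd (by positivity) hε₁ hm)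
  have hmle : (m : ℝ) + 1 ≤ (4 * d + 2) / ε * s := calc
    (m : ℝ) + 1 ≤ 4 * d * s / ε + 2 := by
        linarith [Nat.ceil_lt_add_one (a := 4 * d * s / ε) (by positivity)]
    _ ≤ 4 * d * s / ε + 2 * (s / ε) := by
        linarith [(one_le_div hε₀).2 (hε₁.trans hs)]
    _ = (4 * d + 2) / ε * s := by ring
  have hsd : s ^ d ≤ ((4 * d + 2) / ε) ^ d := by
    refine le_of_mul_le_mul_right ?_ (by positivity : 0 < s ^ d)
    calc s ^ d * s ^ d = N := by rw [← hsN]; ring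
      _ ≤ ((4 * d + 2) / ε * s) ^ d := hNm.trans (by gcongr)
      _ = ((4 * d + 2) / ε) ^ d * s ^ d := mul_pow _ _ _
  calc (N : ℝ) = (s ^ d) ^ 2 := by rw [← hsN]; ring
    _ ≤ (((4 * d + 2) / ε) ^ d) ^ 2 := by gcongr
    _ = ((4 * d + 2) / ε) ^ (2 * d) := by ring

open scoped symmDiff in
lemma card_le_of_measureReal_symmDiff_ge {Ω ι V : Type*} [MeasurableSpace Ω] {μ : Measure Ω}
    [IsProbabilityMeasure μ] [Fintype ι] [Fintype V] {A : ι → Set Ω}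
    (hA : ∀ i, NullMeasurableSet (A i) μ) {ε : ℝ} (hε₀ : 0 < ε) (hε₁ : ε ≤ 1)
    (hsep : ∀ i i', i ≠ i' → ε ≤ μ.real (A i ∆ A i'))
    (hV : ∀ᵐ y : V → Ω ∂Measure.pi fun _ => μ, ¬ FamilyShatters A y) :
    (Fintype.card ι : ℝ) ≤ ((4 * Fintype.card V + 2) / ε) ^ (2 * Fintype.card V) := by
  classical
  refine le_pow_of_forall_sample_le hε₀ hε₁ fun m hm => ?_
  have hm' : (Finset.univ (α := ι)).offDiag.card * (1 - ε) ^ m < 1 := by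
    have hcard : (Finset.univ (α := ι)).offDiag.card ≤ Fintype.card ι ^ 2 := by
      rw [Finset.offDiag_card, sq]
      exact Nat.sub_le _ _
    refine lt_of_le_of_lt (mul_le_mul_of_nonneg_right ?_ (pow_nonneg (sub_nonneg.2 hε₁) m)) hm
    exact_mod_cast hcard
  obtain ⟨y, hy, hhit⟩ := exists_sample_hitting (B := fun p : ι × ι => A p.1 ∆ A p.2)
    (fun p => (hA p.1).symmDiff (hA p.2)) (fun p hp => hsep _ _ (Finset.mem_offDiag.1 hp).2.2) hm'
    (ae_pi_forall_comp hV)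
  have hinj : Function.Injective fun i => y ⁻¹' A i := by
    intro i i' hii
    by_contra hne
    obtain ⟨j, hj⟩ := hhit (i, i') (by simpa using hne)
    have hiff : y j ∈ A i ↔ y j ∈ A i' := Set.ext_iff.1 hii j
    simp only [Set.mem_symmDiff, hiff] at hj
    tauto
  simpa using card_le_pow_of_not_familyShatters hinj hy

end Packing

section PureBigraphon

variable {J₁ J₂ : Type*} [MeasurableSpace J₁] [MeasurableSpace J₂]
  {π₁ : Measure J₁} {π₂ : Measure J₂} {W : J₁ → J₂ → ℝ}

open scoped symmDiff in
lemma integral_abs_sub_eq_measureReal_symmDiff {Ω : Type*} [MeasurableSpace Ω] {μ : Measure Ω}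
    {f g : Ω → ℝ} (hf : AEMeasurable f μ) (hg : AEMeasurable g μ)
    (hf01 : ∀ᵐ b ∂μ, f b = 0 ∨ f b = 1) (hg01 : ∀ᵐ b ∂μ, g b = 0 ∨ g b = 1) :
    ∫ b, |f b - g b| ∂μ = μ.real ({b | f b = 1} ∆ {b | g b = 1}) := by
  have hnull : NullMeasurableSet ({b | f b = 1} ∆ {b | g b = 1}) μ :=
    (hf.nullMeasurable (measurableSet_singleton 1)).symmDiff
      (hg.nullMeasurable (measurableSet_singleton 1))
  have hind : (fun b => |f b - g b|) =ᵐ[μ] ({b | f b = 1} ∆ {b | g b = 1}).indicator 1 := by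
    filter_upwards [hf01, hg01] with b hfb hgb
    rcases hfb with hfb | hfb <;> rcases hgb with hgb | hgb <;>
      simp [Set.indicator, Set.mem_symmDiff, hfb, hgb]
  rw [integral_congr_ae hind, integral_indicator₀ hnull]
  simp

lemma Bigraph.IsAvoidedBy.ae_not_familyShatters [IsProbabilityMeasure π₁]
    [IsProbabilityMeasure π₂] {V : Type} [Fintype V]
    (hV : (Bigraph.ofSubsets V).IsAvoidedBy π₁ π₂ W) {ι : Type*} [Fintype ι] :
    ∀ᵐ x : ι → J₁ ∂Measure.pi fun _ => π₁, ∀ᵐ y : V → J₂ ∂Measure.pi fun _ => π₂,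
      ¬ FamilyShatters (fun i => {b | W (x i) b = 1}) y := by
  filter_upwards [ae_pi_forall_comp (Measure.ae_ae_of_ae_prod hV)] with x hx
  filter_upwards [eventually_all.2 hx] with y hy hshatter
  obtain ⟨g, hg⟩ := hshatter.exists_embedding
  obtain ⟨s, v, hsv⟩ : ∃ (s : Finset V) (v : V),
      v ∈ s ∧ W (x (g s)) (y v) = 0 ∨ v ∉ s ∧ W (x (g s)) (y v) = 1 :=
    Bigraph.indWeight_eq_zero_iff.1 (hy g)
  have hone : W (x (g s)) (y v) = 1 ↔ v ∈ s := hg s v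
  rcases hsv with ⟨hv, h₀⟩ | ⟨hv, h₁⟩
  · exact zero_ne_one (h₀.symm.trans (hone.2 hv))
  · exact hv (hone.1 h₁)

lemma exists_dist_lt_of_ae_pi {M ι : Type*} [PseudoMetricSpace M] [MeasurableSpace M]
    {μ : Measure M} [SigmaFinite μ] [μ.IsOpenPosMeasure] [Fintype ι] {p : (ι → M) → Prop}
    (hp : ∀ᵐ x ∂Measure.pi fun _ => μ, p x) (c : ι → M) {δ : ℝ} (hδ : 0 < δ) :
    ∃ x, p x ∧ ∀ i, dist (c i) (x i) < δ := by
  obtain ⟨x, hx, hcx⟩ := (Measure.dense_of_ae hp).exists_dist_lt c hδ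
  exact ⟨x, hx, fun i => (dist_le_pi_dist c x i).trans_lt hcx⟩

namespace IsPureBigraphon

variable [MetricSpace J₁] [MetricSpace J₂]

lemma swap (hW : IsPureBigraphon π₁ π₂ W) : IsPureBigraphon π₂ π₁ fun b a => W a b where
  prob₁ := hW.prob₂
  prob₂ := hW.prob₁
  aemeasurable := by
    have := hW.prob₁
    have := hW.prob₂
    exact hW.aemeasurable.comp_quasiMeasurePreserving
      Measure.measurePreserving_swap.quasiMeasurePreserving
  mem_Icc b a := hW.mem_Icc a b
  aemeasurable_row := hW.aemeasurable_col
  aemeasurable_col := hW.aemeasurable_row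
  dist_eq₁ := hW.dist_eq₂
  dist_eq₂ := hW.dist_eq₁
  complete₁ := hW.complete₂
  complete₂ := hW.complete₁
  separable₁ := hW.separable₂
  separable₂ := hW.separable₁
  open_pos₁ := hW.open_pos₂
  open_pos₂ := hW.open_pos₁

open scoped symmDiff in
lemma card_le_of_separated (hW : IsPureBigraphon π₁ π₂ W) {V : Type} [Fintype V]
    (hV : (Bigraph.ofSubsets V).IsAvoidedBy π₁ π₂ W) {ε : ℝ} (hε₀ : 0 < ε) (hε₁ : ε ≤ 1)
    {S : Finset J₁} (hS : ∀ x ∈ S, ∀ y ∈ S, x ≠ y → ε ≤ dist x y) :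
    (S.card : ℝ) ≤ ((8 * Fintype.card V + 4) / ε) ^ (2 * Fintype.card V) := by
  have := hW.prob₁
  have := hW.prob₂
  have := hW.open_pos₁
  have h01 : ∀ᵐ x : S → J₁ ∂Measure.pi fun _ => π₁,
      ∀ i, ∀ᵐ b ∂π₂, W (x i) b = 0 ∨ W (x i) b = 1 :=
    eventually_all.2 fun i => (measurePreserving_eval (fun _ => π₁) i).quasiMeasurePreserving.ae
      (Measure.ae_ae_of_ae_prod (hW.ae_zero_or_one hV))
  obtain ⟨x, ⟨hx01, hxV⟩, hSx⟩ := exists_dist_lt_of_ae_pi (h01.and hV.ae_not_familyShatters)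
    (fun i : S => (i : J₁)) (δ := ε / 4) (by positivity)
  have hsep (i i' : S) (hii : i ≠ i') :
      ε / 2 ≤ π₂.real ({b | W (x i) b = 1} ∆ {b | W (x i') b = 1}) := by
    rw [← integral_abs_sub_eq_measureReal_symmDiff (hW.aemeasurable_row _)
      (hW.aemeasurable_row _) (hx01 i) (hx01 i'), ← hW.dist_eq₁]
    linarith [hS i i.2 i' i'.2 (Subtype.coe_ne_coe.2 hii), hSx i, hSx i',
      dist_triangle4_right (i : J₁) i' (x i) (x i')]
  have hcard := card_le_of_measureReal_symmDiff_ge (A := fun i : S => {b | W (x i) b = 1})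
    (fun i => (hW.aemeasurable_row (x i)).nullMeasurable (measurableSet_singleton 1))
    (half_pos hε₀) ((half_le_self hε₀.le).trans hε₁) hsep hxV
  rw [Fintype.card_coe] at hcard
  convert hcard using 2
  ring

end IsPureBigraphon

end PureBigraphon

section PackingDimension

variable {M : Type*} [MetricSpace M]

lemma packingCount_antitone : Antitone (packingCount M) := fun _ _ h =>
  iSup_mono fun _ => iSup_const_mono fun hS x hx y hy hxy => h.trans (hS x hx y hy hxy)

lemma packingCount_le_ofReal {ε B : ℝ}
    (h : ∀ S : Finset M, (∀ x ∈ S, ∀ y ∈ S, x ≠ y → ε ≤ dist x y) → (S.card : ℝ) ≤ B) :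
    (packingCount M ε : ℝ≥0∞) ≤ ENNReal.ofReal B := by
  simp only [packingCount, ENat.toENNReal_iSup, ENat.toENNReal_coe]
  exact iSup₂_le fun S hS => ENNReal.ofReal_natCast S.card ▸ ENNReal.ofReal_le_ofReal (h S hS)

open scoped NNReal in
lemma packingNumber_univ_le_packingCount (r : ℝ≥0) :
    Metric.packingNumber r (Set.univ : Set M) ≤ packingCount M r := by
  refine iSup₂_le fun T _ => iSup_le fun hT => ENat.forall_natCast_le_iff_le.1 fun n hn => ?_
  obtain ⟨t, htT, htn⟩ := Set.exists_subset_encard_eq hn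
  have htfin : t.Finite := Set.finite_of_encard_eq_coe htn
  have hsep : ∀ x ∈ htfin.toFinset, ∀ y ∈ htfin.toFinset, x ≠ y → (r : ℝ) ≤ dist x y := by
    intro x hx y hy hxy
    have hlt : (r : ℝ≥0∞) < edist x y :=
      hT (htT (htfin.mem_toFinset.1 hx)) (htT (htfin.mem_toFinset.1 hy)) hxy
    rw [edist_nndist, ENNReal.coe_lt_coe] at hlt
    exact_mod_cast hlt.le
  rw [← htn, htfin.encard_eq_coe_toFinset_card]
  exact le_iSup₂_of_le htfin.toFinset hsep le_rfl

lemma totallyBounded_univ_of_packingCount_ne_top (h : ∀ r : ℝ, 0 < r → packingCount M r ≠ ⊤) :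
    TotallyBounded (Set.univ : Set M) := by
  refine Metric.totallyBounded_iff.2 fun ε hε => ?_
  lift ε to NNReal using hε.le
  have hfin : Metric.packingNumber (ε / 2) (Set.univ : Set M) ≠ ⊤ :=
    ne_top_of_le_ne_top (h _ (by simpa using hε)) (packingNumber_univ_le_packingCount _)
  refine ⟨Metric.maximalSeparatedSet (ε / 2) Set.univ, ?_, ?_⟩
  · rwa [← Set.encard_ne_top_iff, Metric.encard_maximalSeparatedSet hfin]
  · refine (Metric.isCover_iff_subset_iUnion_closedBall.1
      (Metric.isCover_maximalSeparatedSet hfin)).trans (Set.iUnion₂_mono fun y _ => ?_)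
    exact Metric.closedBall_subset_ball (by simpa using hε)

lemma compactSpace_of_packingCount_ne_top [CompleteSpace M]
    (h : ∀ᶠ ε : ℝ in 𝓝[>] 0, packingCount M ε ≠ ⊤) : CompactSpace M := by
  rw [← isCompact_univ_iff, isCompact_iff_totallyBounded_isComplete]
  refine ⟨totallyBounded_univ_of_packingCount_ne_top fun r hr => ?_, isComplete_univ⟩
  obtain ⟨ε, hε, hεr⟩ := (h.and (Ioo_mem_nhdsGT hr)).exists
  exact ne_top_of_le_ne_top hε (packingCount_antitone hεr.2.le)

lemma tendsto_log_div_rpow_div_log {C : ℝ} (hC : 0 < C) (a : ℝ) :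
    Tendsto (fun ε => Real.log ((C / ε) ^ a) / Real.log (1 / ε)) (𝓝[>] 0) (𝓝 a) := by
  have hlog : Tendsto (fun ε : ℝ => Real.log (1 / ε)) (𝓝[>] 0) atTop := by
    simp only [one_div, Real.log_inv]
    exact tendsto_neg_atBot_atTop.comp Real.tendsto_log_nhdsGT_zero
  have hlim : Tendsto (fun ε : ℝ => a * (Real.log C / Real.log (1 / ε) + 1)) (𝓝[>] 0) (𝓝 a) := by
    simpa using ((hlog.const_div_atTop (Real.log C)).add_const 1).const_mul a
  refine hlim.congr' ?_
  filter_upwards [hlog.eventually_gt_atTop 0, self_mem_nhdsWithin] with ε hlogε hε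
  have hε₀ : (0 : ℝ) < ε := hε
  rw [Real.log_rpow (by positivity), div_eq_mul_one_div C, Real.log_mul hC.ne' (by positivity)]
  field_simp

lemma packingDim_le {C a : ℝ} (hC : 0 < C)
    (h : ∀ᶠ ε : ℝ in 𝓝[>] 0, (packingCount M ε : ℝ≥0∞) ≤ ENNReal.ofReal ((C / ε) ^ a)) :
    packingDim M ≤ a := by
  have hlim := (continuous_coe_real_ereal.tendsto a).comp (tendsto_log_div_rpow_div_log hC a)
  refine (limsup_le_limsup ?_).trans_eq hlim.limsup_eq
  filter_upwards [h, Ioo_mem_nhdsGT one_pos] with ε hle hε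
  have hε₀ : 0 < ε := hε.1
  have hlog : 0 < Real.log (1 / ε) := Real.log_pos ((one_lt_div hε₀).2 hε.2)
  have hpow : 0 < (C / ε) ^ a := by positivity
  rw [Function.comp_apply, EReal.coe_div, ← ENNReal.log_ofReal_of_pos hpow]
  exact EReal.div_le_div_right_of_nonneg (by exact_mod_cast hlog.le) (ENNReal.log_le_log hle)

lemma IsPureBigraphon.compactSpace_and_packingDim_le {J₁ J₂ : Type*} [MeasurableSpace J₁]
    [MeasurableSpace J₂] [MetricSpace J₁] [MetricSpace J₂] {π₁ : Measure J₁} {π₂ : Measure J₂}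
    {W : J₁ → J₂ → ℝ} (hW : IsPureBigraphon π₁ π₂ W) {V : Type} [Fintype V]
    (hV : (Bigraph.ofSubsets V).IsAvoidedBy π₁ π₂ W) :
    CompactSpace J₁ ∧ packingDim J₁ ≤ ((2 * Fintype.card V : ℕ) : ℝ) := by
  have := hW.complete₁
  have hcount : ∀ᶠ ε : ℝ in 𝓝[>] 0, (packingCount J₁ ε : ℝ≥0∞) ≤
      ENNReal.ofReal (((8 * Fintype.card V + 4) / ε) ^ ((2 * Fintype.card V : ℕ) : ℝ)) := by
    filter_upwards [Ioc_mem_nhdsGT one_pos] with ε hε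
    rw [Real.rpow_natCast]
    exact packingCount_le_ofReal fun S => hW.card_le_of_separated hV hε.1 hε.2
  refine ⟨compactSpace_of_packingCount_ne_top (hcount.mono fun ε hε => ?_),
    packingDim_le (by positivity) hcount⟩
  exact ENat.toENNReal_ne_top.1 (ne_top_of_le_ne_top ENNReal.ofReal_ne_top hε)

end PackingDimension

theorem corollary4p3 (P : Bigraph → Prop) (hP : Bigraph.IsHereditary P)
    (hne : ∃ F : Bigraph, ¬ P F) :
    ∃ d : ℝ, ∀ (J₁ J₂ : Type*) [MeasurableSpace J₁] [MeasurableSpace J₂]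
      [MetricSpace J₁] [MetricSpace J₂]
      (π₁ : Measure J₁) (π₂ : Measure J₂) (W : J₁ → J₂ → ℝ),
      IsPureBigraphon π₁ π₂ W → InClosure P π₁ π₂ W →
        (∀ᵐ p ∂(π₁.prod π₂), W p.1 p.2 = 0 ∨ W p.1 p.2 = 1) ∧
        CompactSpace J₁ ∧ CompactSpace J₂ ∧
        packingDim J₁ ≤ (d : EReal) ∧ packingDim J₂ ≤ (d : EReal) := by
  obtain ⟨V, _, hPV, hPV'⟩ := hP.exists_not_ofSubsets hne
  refine ⟨(2 * Fintype.card V : ℕ), fun J₁ J₂ _ _ _ _ π₁ π₂ W hW hcl => ?_⟩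
  have := hW.prob₁
  have := hW.prob₂
  have htwin := Bigraph.isTwinFree_ofSubsets V
  have hV : (Bigraph.ofSubsets V).IsAvoidedBy π₁ π₂ W :=
    hW.isAvoidedBy_of_inClosure hP hcl htwin hPV
  have hV' : (Bigraph.ofSubsets V).IsAvoidedBy π₂ π₁ fun b a => W a b :=
    (hW.isAvoidedBy_of_inClosure hP hcl htwin.flip hPV').of_flip
  obtain ⟨hcompact₁, hdim₁⟩ := hW.compactSpace_and_packingDim_le hV
  obtain ⟨hcompact₂, hdim₂⟩ := hW.swap.compactSpace_and_packingDim_le hV'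
  exact ⟨hW.ae_zero_or_one hV, hcompact₁, hcompact₂, hdim₁, hdim₂⟩
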